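/- For integers $\alpha,\beta$, $z\in\mathbb C$ and $\operatorname{Im}\tau>0$ let $$\theta\!\left[{\alpha\atop\beta}\right]\!(z|\tau)=\sum_{k=-\infty}^{\infty}\exp\Big\{\pi i\big(k+\tfrac\alpha2\big)^2\tau+2\pi i\big(k+\tfrac\alpha2\big)\big(z+\tfrac\beta2\big)\Big\}.$$ Let $[p]$ denote the integer part of the rational number $p$ obtained by dropping the fractional digits (so $[-p]=-[p]$); let $\sqrt{\cdot}$ be the principal square root, and $i^x=e^{\pi i x/2}$. (1) For all $n,\alpha,\beta\in\mathbb Z$, $z\in\mathbb C$, $\operatorname{Im}\tau>0$, $$\theta\!\left[{\alpha-1\atop\beta}\right]\!(z|\tau+n)=i^{\frac n2(1-\alpha^2)}\,\theta\!\left[{\alpha-1\atop\beta+n\alpha}\right]\!(z|\tau).$$ (2) Let $\begin{pmatrix}a&b\\c&d\end{pmatrix}$ be an integer matrix of determinant $1$ with $c>0$ (every element of $\Gamma(1)=\mathrm{PSL}_2(\mathbb Z)$ that is not a translation $\tau\mapsto\tau+n$ has exactly one such representative), and let the integers $\alpha,\beta,\alpha',\beta'$ be related by $$\alpha'=d\alpha-c\beta,\quad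 \beta'=-b\alpha+a\beta,$$ or, equivalently, $$\alpha=a\alpha'+c\beta',\quad \beta=b\alpha'+d\beta'.$$ Then for all $z\in\mathbb C$ and $\operatorname{Im}\tau>0$ $$\theta\!\left[{\alpha'-1\atop\beta'-1}\right]\!\Big(\frac{z}{c\tau+d}\Big|\frac{a\tau+b}{c\tau+d}\Big)=\mathfrak E_{\alpha\beta}\,\aleph\,\sqrt{c\tau+d}\;e^{\frac{\pi i c z^2}{c\tau+d}}\;\theta\!\left[{\alpha-1\atop\beta-1}\right]\!(z|\tau),$$ where $\mathfrak E_{\alpha\beta}$ and $\aleph$ are the eighth roots of unity $$\mathfrak E_{\alpha\beta}=\exp\frac{\pi i}4\Big\{2\alpha(\beta bc-d+1)-\beta c(\beta a-2)-\alpha^2db\Big\},$$ $$\aleph=\exp 3\pi i\Big\{\frac{a-d}{12c}-\frac d6(2c-3)+\frac{c-1}4\operatorname{sign}(d)-\frac14+\frac1c\sum_{k=|[c/d]|+1}^{c-1}\Big[\frac dc k\Big]k\Big\}.$$ Here $\operatorname{sign}(0)=0$, a sum whose lower limit exceeds its upper limit is $0$, and for $d=0$ (so $c=1$) the sum is taken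 to be $0$. -/

import Mathlib

/-- The `k`-th term of the theta-series with integer characteristics `α`, `β`. -/
noncomputable def thetaTerm (α β : ℤ) (z τ : ℂ) (k : ℤ) : ℂ :=
  Complex.exp (Real.pi * Complex.I * ((k : ℂ) + α / 2) ^ 2 * τ
    + 2 * Real.pi * Complex.I * ((k : ℂ) + α / 2) * (z + β / 2))

/-- The theta-series with integer characteristics `α`, `β`, at `(z | τ)`. -/
noncomputable def thetaChar (α β : ℤ) (z τ : ℂ) : ℂ :=
  ∑' k : ℤ, thetaTerm α β z τ k

/-- The theta-series converges (absolutely) on the upper half-plane, so `thetaChar` is its sum. -/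
theorem summable_thetaTerm (α β : ℤ) (z τ : ℂ) (hτ : 0 < τ.im) :
    Summable (thetaTerm α β z τ) := by
  have h := ((summable_jacobiTheta₂_term_iff (z + β / 2 + α / 2 * τ) τ).2 hτ).mul_left
    (Complex.exp (Real.pi * Complex.I * (α / 2) ^ 2 * τ
      + 2 * Real.pi * Complex.I * (α / 2) * (z + β / 2)))
  refine h.congr fun k => ?_
  rw [thetaTerm, jacobiTheta₂_term, ← Complex.exp_add]
  congr 1
  ring

/-- The integer part `[x]` of a rational number: the fractional digits are dropped, so that
`[-x] = -[x]`. -/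
def integerPart (x : ℚ) : ℤ := if 0 ≤ x then ⌊x⌋ else ⌈x⌉

/-- The multiplier `𝔈_{αβ}(a, b, c, d)`, which depends on the characteristics. -/
noncomputable def multE (α β a b c d : ℤ) : ℂ :=
  Complex.exp (Real.pi / 4 * Complex.I *
    ((2 * α * (β * b * c - d + 1) - β * c * (β * a - 2) - α ^ 2 * d * b : ℤ) : ℂ))

/-- The expression in braces in the definition of the multiplier `ℵ`. The sum runs over the
integers `k` with `|[c/d]| + 1 ≤ k ≤ c - 1`, and is zero if there are none; for a matrix of
determinant one with `c > 0` and `d = 0` one has `c = 1`, and there are none. -/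
noncomputable def alephExponent (a c d : ℤ) : ℚ :=
  ((a : ℚ) - d) / (12 * c) - (d : ℚ) / 6 * (2 * c - 3) + ((c : ℚ) - 1) / 4 * (d.sign : ℚ) - 1 / 4
    + 1 / (c : ℚ) * ∑ k ∈ Finset.Icc (|integerPart ((c : ℚ) / d)| + 1) (c - 1),
        (integerPart ((d : ℚ) / c * k) : ℚ) * (k : ℚ)

/-- The multiplier `ℵ`, which does not depend on the characteristics. -/
noncomputable def multAleph (a c d : ℤ) : ℂ :=
  Complex.exp (3 * Real.pi * Complex.I * ((alephExponent a c d : ℚ) : ℂ))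

/-! For (1), after the constant factor is split off, exponents of corresponding terms differ by `πi
n k(k-1)`, a multiple of `2πi`. For (2), `thetaChar_add` trades characteristics for a half-period
shift of the argument, so only the odd series with characteristics `(-1, -1)` needs a transformation
law; the exponentials produced by the shifts combine into `multE` (`thetaChar_transform_of_odd`).
For the odd series, `thetaChar_odd_transform` runs the Euclidean algorithm on the lower row `(c,
d)`: splitting off a translation and an inversion leaves the lower row `(d mod c, -c)`. The exponent
`(a+d)/(12c) - s(d,c) - 1/4` obeys the matching recursion by `dedekindSum_reciprocity`. Expanding
the Dedekind sum into integer parts identifies this exponent with that of `ℵ` (`alephExponent_eq`).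
-/

/-! ### Theta-series under half-period shifts, translation and inversion -/

open Complex in
/-- Shifting the characteristics amounts to shifting the argument by a half-period. -/
theorem thetaChar_add (α β α₀ β₀ : ℤ) (z τ : ℂ) :
    thetaChar (α + α₀) (β + β₀) z τ =
      cexp (Real.pi * I * (α ^ 2 * τ / 4 + α * (z + (β + β₀) / 2))) *
        thetaChar α₀ β₀ (z + (α * τ + β) / 2) τ := by
  rw [thetaChar, thetaChar, ← tsum_mul_left]
  refine tsum_congr fun k => ?_
  rw [thetaTerm, thetaTerm, ← Complex.exp_add]
  congr 1
  push_cast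
  ring

open Complex in
theorem thetaChar_eq_jacobiTheta₂ (α β : ℤ) (z τ : ℂ) :
    thetaChar α β z τ =
      cexp (Real.pi * I * (α ^ 2 * τ / 4 + α * (z + β / 2))) *
        jacobiTheta₂ (z + (α * τ + β) / 2) τ := by
  rw [thetaChar, jacobiTheta₂, ← tsum_mul_left]
  refine tsum_congr fun k => ?_
  rw [thetaTerm, jacobiTheta₂_term, ← Complex.exp_add]
  congr 1
  ring

open Complex in
theorem thetaTerm_add_int (n α β : ℤ) (z τ : ℂ) (k : ℤ) :
    thetaTerm (α - 1) β z (τ + n) k =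
      cexp (Real.pi * I * (n * (1 - α ^ 2) / 4)) * thetaTerm (α - 1) (β + n * α) z τ k := by
  obtain ⟨m, hm⟩ := Int.even_mul_pred_self k
  have hm' : (k : ℂ) * (k - 1) = m + m := by exact_mod_cast hm
  rw [thetaTerm, thetaTerm, ← Complex.exp_add, Complex.exp_eq_exp_iff_exists_int]
  refine ⟨n * m, ?_⟩
  push_cast
  linear_combination (Real.pi * I * n) * hm'

open Complex in
theorem I_cpow_half_mul (x : ℂ) : I ^ (x / 2) = cexp (Real.pi * I * (x / 4)) := by
  rw [Complex.cpow_def_of_ne_zero I_ne_zero, Complex.log_I]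
  congr 1
  ring

open Complex in
theorem thetaChar_add_int (n α β : ℤ) (z τ : ℂ) :
    thetaChar (α - 1) β z (τ + n) =
      cexp (Real.pi * I * (n * (1 - α ^ 2) / 4)) * thetaChar (α - 1) (β + n * α) z τ := by
  rw [thetaChar, thetaChar, ← tsum_mul_left]
  exact tsum_congr (thetaTerm_add_int n α β z τ)

open Complex in
theorem thetaChar_odd_add_int (n : ℤ) (z τ : ℂ) :
    thetaChar (-1) (-1) z (τ + n) =
      cexp (Real.pi * I * (n / 4)) * thetaChar (-1) (-1) z τ := by
  simpa using thetaChar_add_int n 0 (-1) z τ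

open Complex in
theorem thetaChar_odd_neg (z τ : ℂ) :
    thetaChar (-1) (-1) (-z) τ = -thetaChar (-1) (-1) z τ := by
  -- The reflection `k ↦ 1 - k` negates `k - 1/2`; the sign is `exp (2πi(k - 1/2)) = -1`.
  rw [thetaChar, thetaChar, ← (Equiv.subLeft (1 : ℤ)).tsum_eq, ← tsum_neg]
  refine tsum_congr fun k => ?_
  have h : -1 = cexp (Real.pi * I) := by rw [Complex.exp_pi_mul_I]
  rw [thetaTerm, thetaTerm, neg_eq_neg_one_mul (cexp _), h, ← Complex.exp_add,
    Complex.exp_eq_exp_iff_exists_int]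
  refine ⟨k - 1, ?_⟩
  simp only [Equiv.subLeft_apply]
  push_cast
  ring

open Complex in
theorem re_im_cpow_half_pos {w : ℂ} (hw : 0 < w.im) :
    0 < (w ^ (1 / 2 : ℂ)).re ∧ 0 < (w ^ (1 / 2 : ℂ)).im := by
  have h0 : w ≠ 0 := by rintro rfl; simp at hw
  have harg : 0 < w.arg := (Complex.arg_nonneg_iff.2 hw.le).lt_of_ne fun h =>
    hw.ne' (Complex.arg_eq_zero_iff.1 h.symm).2
  have hπ := Complex.arg_le_pi w
  have e : Complex.log w * (1 / 2) = ((Real.log ‖w‖ / 2 : ℝ) : ℂ) + ((w.arg / 2 : ℝ) : ℂ) * I := by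
    rw [Complex.log]; push_cast; ring
  rw [Complex.cpow_def_of_ne_zero h0, e]
  have hlt : w.arg < Real.pi := by
    refine hπ.lt_of_ne fun h => hw.ne' (Complex.arg_eq_pi_iff.1 h).2
  refine ⟨?_, ?_⟩
  · rw [Complex.exp_re]
    refine mul_pos (Real.exp_pos _) (Real.cos_pos_of_mem_Ioo ⟨?_, ?_⟩) <;> simp <;> linarith
  · rw [Complex.exp_im]
    refine mul_pos (Real.exp_pos _) (Real.sin_pos_of_pos_of_lt_pi ?_ ?_) <;> simp <;> linarith

theorem cpow_half_sq (w : ℂ) : (w ^ (1 / 2 : ℂ)) ^ 2 = w := by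
  rw [one_div]; exact_mod_cast Complex.cpow_nat_inv_pow w two_ne_zero

/-- The squares agree, and the sign is settled by imaginary parts: all three roots lie in the open
first quadrant, so both sides have positive imaginary part. This fixes the branch when automorphy
factors are composed. -/
theorem cpow_half_mul_of_mul_eq_neg {u v w : ℂ} (hu : 0 < u.im) (hv : 0 < v.im) (hw : 0 < w.im)
    (h : w * v = -u) :
    w ^ (1 / 2 : ℂ) * v ^ (1 / 2 : ℂ) = Complex.I * u ^ (1 / 2 : ℂ) := by
  obtain ⟨u1, u2⟩ := re_im_cpow_half_pos hu
  obtain ⟨v1, v2⟩ := re_im_cpow_half_pos hv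
  obtain ⟨w1, w2⟩ := re_im_cpow_half_pos hw
  have hsq : (w ^ (1 / 2 : ℂ) * v ^ (1 / 2 : ℂ)) ^ 2 = (Complex.I * u ^ (1 / 2 : ℂ)) ^ 2 := by
    rw [mul_pow, mul_pow, cpow_half_sq, cpow_half_sq, cpow_half_sq, h, Complex.I_sq]; ring
  refine (sq_eq_sq_iff_eq_or_eq_neg.1 hsq).resolve_right fun hneg => ?_
  have := congrArg Complex.im hneg
  simp only [Complex.mul_im, Complex.neg_im, Complex.I_re, Complex.I_im, zero_mul, one_mul,
    zero_add] at this
  have := mul_pos w1 v2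
  have := mul_pos w2 v1
  linarith

open Complex in
theorem cpow_half_neg_I_mul {τ : ℂ} (hτ : 0 < τ.im) :
    (-I * τ) ^ (1 / 2 : ℂ) = cexp (-(Real.pi * I / 4)) * τ ^ (1 / 2 : ℂ) := by
  have h0 : τ ≠ 0 := by rintro rfl; simp at hτ
  have h1 : -I ≠ 0 := neg_ne_zero.2 I_ne_zero
  have hpos : 0 < τ.arg := (Complex.arg_nonneg_iff.2 hτ.le).lt_of_ne fun h =>
    hτ.ne' (Complex.arg_eq_zero_iff.1 h.symm).2
  have hle := Complex.arg_le_pi τ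
  have hlog : Complex.log (-I * τ) = Complex.log (-I) + Complex.log τ := by
    refine (Complex.log_mul_eq_add_log_iff h1 h0).2 ?_
    rw [Complex.arg_neg_I]
    constructor <;> linarith [Real.pi_pos]
  rw [Complex.cpow_def_of_ne_zero (mul_ne_zero h1 h0), Complex.cpow_def_of_ne_zero h0, hlog,
    Complex.log_neg_I, ← Complex.exp_add]
  congr 1
  ring

open Complex in
/-- The inversion law of the odd theta-function. -/
theorem thetaChar_odd_inversion {τ : ℂ} (hτ : 0 < τ.im) (z : ℂ) :
    thetaChar (-1) (-1) (z / τ) (-1 / τ) =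
      cexp (-(3 * Real.pi * I / 4)) * τ ^ (1 / 2 : ℂ) * cexp (Real.pi * I * z ^ 2 / τ) *
        thetaChar (-1) (-1) z τ := by
  have h0 : τ ≠ 0 := by rintro rfl; simp at hτ
  have hs : τ ^ (1 / 2 : ℂ) ≠ 0 := fun h => h0 (by rw [← cpow_half_sq τ, h]; simp)
  -- The half-period shift at `-1/τ` misses the rescaled shift at `τ` by the period `-1/τ`, so
  -- quasi-periodicity is needed as well.
  have hu : z / τ + (((-1 : ℤ) : ℂ) * (-1 / τ) + ((-1 : ℤ) : ℂ)) / 2 + -1 / τ =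
      (z + (((-1 : ℤ) : ℂ) * τ + ((-1 : ℤ) : ℂ)) / 2) / τ := by
    field_simp
    push_cast
    ring
  rw [thetaChar_eq_jacobiTheta₂ _ _ z, thetaChar_eq_jacobiTheta₂, jacobiTheta₂_functional_equation
    (z + (((-1 : ℤ) : ℂ) * τ + ((-1 : ℤ) : ℂ)) / 2), ← hu, jacobiTheta₂_add_left',
    cpow_half_neg_I_mul hτ, ← mul_assoc, ← mul_assoc, ← mul_assoc]
  congr 1
  rw [one_div (_ * _), mul_inv, ← Complex.exp_neg]
  have hc : ∀ A B C D E F : ℂ, A * τ ^ (1 / 2 : ℂ) * B * C * (D * (τ ^ (1 / 2 : ℂ))⁻¹ * E) * F =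
      A * B * C * D * E * F := fun A B C D E F => by field_simp
  rw [hc]
  simp only [← Complex.exp_add]
  congr 1
  field_simp
  push_cast
  ring
-- Dedekind sums and reciprocity
/-- The Dedekind sum `s(d, c)`. -/
def dedekindSum (d : ℤ) (c : ℕ) : ℚ :=
  ∑ k ∈ Finset.range c, (k : ℚ) / c * (((d * k % c : ℤ) : ℚ) / c - 1 / 2)

theorem dedekindSum_one (d : ℤ) : dedekindSum d 1 = 0 := by
  simp [dedekindSum]

theorem dedekindSum_add_mul (d n : ℤ) (c : ℕ) : dedekindSum (d + n * c) c = dedekindSum d c := by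
  refine Finset.sum_congr rfl fun k _ => ?_
  rw [show (d + n * c) * (k : ℤ) = d * k + c * (n * k) by ring, Int.add_mul_emod_self_left]

theorem dedekindSum_neg {d : ℤ} {c : ℕ} (h : IsCoprime d c) :
    dedekindSum (-d) c = -dedekindSum d c := by
  rw [dedekindSum, dedekindSum, ← Finset.sum_neg_distrib]
  refine Finset.sum_congr rfl fun k hk => ?_
  have hkc := Finset.mem_range.1 hk
  rcases Nat.eq_zero_or_pos k with rfl | hk0
  · simp
  have hc0 : (c : ℚ) ≠ 0 := by
    have : c ≠ 0 := by omega
    exact_mod_cast this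
  have hnd : ¬ (c : ℤ) ∣ d * k := fun hd => by
    have := Int.le_of_dvd (by omega) (h.symm.dvd_of_dvd_mul_left hd)
    omega
  have hmod : -d * k % c = c - d * k % c := by
    rw [neg_mul, Int.neg_emod, if_neg hnd]
    simp
  rw [hmod]
  push_cast
  field_simp
  ring

theorem sum_range_cast_rat (n : ℕ) :
    ∑ k ∈ Finset.range n, (k : ℚ) = n * (n - 1) / 2 := by
  induction n with
  | zero => simp
  | succ n ih => rw [Finset.sum_range_succ, ih]; push_cast; ring

theorem sum_range_cast_sq_rat (n : ℕ) :
    ∑ k ∈ Finset.range n, (k : ℚ) ^ 2 = n * (n - 1) * (2 * n - 1) / 6 := by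
  induction n with
  | zero => simp
  | succ n ih => rw [Finset.sum_range_succ, ih]; push_cast; ring

/-- Multiplication by a unit permutes the residues modulo `k`. -/
theorem sum_range_mul_mod {M : Type*} [AddCommMonoid M] {h k : ℕ} (hc : Nat.Coprime h k)
    (hk : 0 < k) (f : ℕ → M) :
    ∑ j ∈ Finset.range k, f (h * j % k) = ∑ j ∈ Finset.range k, f j := by
  have hmaps : ∀ j ∈ Finset.range k, h * j % k ∈ Finset.range k := fun j _ =>
    Finset.mem_range.2 (Nat.mod_lt _ hk)
  have hinj : Set.InjOn (fun j => h * j % k) (Finset.range k : Set ℕ) := by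
    intro i hi j hj hij
    have hi' : i < k := by simpa using hi
    have hj' : j < k := by simpa using hj
    have := Nat.ModEq.cancel_left_of_coprime (hc.symm) (show h * i ≡ h * j [MOD k] from hij)
    exact Nat.ModEq.eq_of_lt_of_lt this hi' hj'
  have himg : (Finset.range k).image (fun j => h * j % k) = Finset.range k :=
    Finset.eq_of_subset_of_card_le (Finset.image_subset_iff.2 hmaps)
      (by rw [Finset.card_image_of_injOn hinj])
  conv_rhs => rw [← himg]
  rw [Finset.sum_image hinj]

/-- The linear term of the Dedekind sum in terms of the sum of `j ⌊h j / k⌋`. -/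
theorem dedekindSum_eq_sum_div (h k : ℕ) (hk : 0 < k) :
    dedekindSum h k = (h : ℚ) * (k - 1) * (2 * k - 1) / (6 * k) - ((k : ℚ) - 1) / 4
      - (∑ j ∈ Finset.range k, (j : ℚ) * (h * j / k : ℕ)) / k := by
  have hk0 : (k : ℚ) ≠ 0 := by exact_mod_cast hk.ne'
  have hterm : ∀ j : ℕ, (j : ℚ) / k * ((((h : ℤ) * j % k : ℤ) : ℚ) / k - 1 / 2) =
      h / k ^ 2 * (j : ℚ) ^ 2 - 1 / (2 * k) * j - 1 / k * ((j : ℚ) * (h * j / k : ℕ)) := fun j => by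
    have h1 : ((h * j % k : ℕ) : ℚ) = h * j - k * (h * j / k : ℕ) := by
      have := Nat.mod_add_div (h * j) k
      rw [eq_sub_iff_add_eq]
      exact_mod_cast this
    have h2 : (((h : ℤ) * j % k : ℤ) : ℚ) = ((h * j % k : ℕ) : ℚ) := by norm_cast
    rw [h2, h1]
    field_simp
    ring
  rw [dedekindSum, Finset.sum_congr rfl fun j _ => hterm j, Finset.sum_sub_distrib,
    Finset.sum_sub_distrib, ← Finset.mul_sum, ← Finset.mul_sum, ← Finset.mul_sum,
    sum_range_cast_sq_rat, sum_range_cast_rat]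
  field_simp
  ring

theorem sum_range_mul_div {h k : ℕ} (hc : Nat.Coprime h k) (hk : 0 < k) :
    ∑ j ∈ Finset.range k, ((h * j / k : ℕ) : ℚ) = ((h : ℚ) - 1) * (k - 1) / 2 := by
  have hk0 : (k : ℚ) ≠ 0 := by exact_mod_cast hk.ne'
  have h1 : ∀ j : ℕ, ((h * j / k : ℕ) : ℚ) = h / k * j - 1 / k * (h * j % k : ℕ) := fun j => by
    have : ((h * j % k : ℕ) : ℚ) + k * (h * j / k : ℕ) = h * j := by
      exact_mod_cast Nat.mod_add_div (h * j) k
    field_simp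
    linarith
  rw [Finset.sum_congr rfl fun j _ => h1 j, Finset.sum_sub_distrib, ← Finset.mul_sum,
    ← Finset.mul_sum, sum_range_mul_mod hc hk (fun j => (j : ℚ)), sum_range_cast_rat]
  field_simp

/-- Both sides sum `m` over the lattice points `(j, m)` with `k m ≤ h j`. -/
theorem sum_range_triangle {h k : ℕ} (hc : Nat.Coprime h k) (hk : 0 < k) (hh : 0 < h) :
    ∑ j ∈ Finset.range k, ((h * j / k : ℕ) : ℚ) * ((h * j / k : ℕ) + 1) / 2 =
      ∑ m ∈ Finset.range h, (m : ℚ) * (k - 1 - (k * m / h : ℕ)) := by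
  have hl : ∀ j ∈ Finset.range k, ((h * j / k : ℕ) : ℚ) * ((h * j / k : ℕ) + 1) / 2 =
      ∑ m ∈ Finset.range h, if k * m ≤ h * j then (m : ℚ) else 0 := fun j hj => by
    have hjk := Finset.mem_range.1 hj
    rw [← Finset.sum_filter]
    have : (Finset.range h).filter (fun m => k * m ≤ h * j) = Finset.range (h * j / k + 1) := by
      ext m
      rw [Finset.mem_filter, Finset.mem_range, Finset.mem_range, Nat.lt_succ_iff,
        Nat.le_div_iff_mul_le hk, mul_comm m k]
      refine ⟨fun H => H.2, fun H => ⟨?_, H⟩⟩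
      by_contra hm
      have h1 : k * h ≤ k * m := Nat.mul_le_mul_left _ (not_lt.1 hm)
      have h2 : h * j < h * k := Nat.mul_lt_mul_of_pos_left hjk hh
      rw [mul_comm k h] at h1
      omega
    rw [this, sum_range_cast_rat]
    push_cast
    ring
  have hr : ∀ m ∈ Finset.range h, (m : ℚ) * (k - 1 - (k * m / h : ℕ)) =
      ∑ j ∈ Finset.range k, if k * m ≤ h * j then (m : ℚ) else 0 := fun m hm => by
    have hmh := Finset.mem_range.1 hm
    -- For `m = 0` the count of `j` below would be off by one, but the weight vanishes.
    rcases Nat.eq_zero_or_pos m with rfl | hm0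
    · simp
    have hlt : k * m / h < k := by
      rw [Nat.div_lt_iff_lt_mul hh]
      exact Nat.mul_lt_mul_of_pos_left hmh hk
    have : (Finset.range k).filter (fun j => k * m ≤ h * j) = Finset.Ico (k * m / h + 1) k := by
      ext j
      rw [Finset.mem_filter, Finset.mem_range, Finset.mem_Ico, Nat.succ_le_iff,
        Nat.div_lt_iff_lt_mul hh, and_comm, mul_comm j h]
      refine and_congr_left fun hjk => ⟨fun H => lt_of_le_of_ne H fun he => ?_, fun H => H.le⟩
      have hd : h ∣ m := hc.dvd_of_dvd_mul_left ⟨j, he⟩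
      exact absurd (Nat.le_of_dvd hm0 hd) (by omega)
    rw [← Finset.sum_filter, this, Finset.sum_const, Nat.card_Ico, nsmul_eq_mul, Nat.cast_sub hlt]
    push_cast
    ring
  rw [Finset.sum_congr rfl hl, Finset.sum_congr rfl hr, Finset.sum_comm]

/-- The reciprocity law of the Dedekind sums. -/
theorem dedekindSum_reciprocity {h k : ℕ} (hc : Nat.Coprime h k) (hk : 0 < k) (hh : 0 < h) :
    dedekindSum h k + dedekindSum k h =
      -1 / 4 + ((h : ℚ) / k + k / h + 1 / (h * k)) / 12 := by
  have hk0 : (k : ℚ) ≠ 0 := by exact_mod_cast hk.ne'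
  have hh0 : (h : ℚ) ≠ 0 := by exact_mod_cast hh.ne'
  rw [dedekindSum_eq_sum_div h k hk, dedekindSum_eq_sum_div k h hh]
  -- The squares of the residues `h j mod k` are summed in two ways: by permutation, and by
  -- expanding `h j - k ⌊h j / k⌋`. The lattice-point count turns the quadratic floor terms into the
  -- sum with `h` and `k` exchanged.
  have hsq : ∑ j ∈ Finset.range k, ((h * j % k : ℕ) : ℚ) ^ 2 = ∑ j ∈ Finset.range k, (j : ℚ) ^ 2 :=
    sum_range_mul_mod hc hk (fun j => (j : ℚ) ^ 2)
  have hmod : ∀ j : ℕ, ((h * j % k : ℕ) : ℚ) ^ 2 =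
      h ^ 2 * (j : ℚ) ^ 2 - 2 * h * k * ((j : ℚ) * (h * j / k : ℕ))
        + 2 * k ^ 2 * (((h * j / k : ℕ) : ℚ) * ((h * j / k : ℕ) + 1) / 2)
        - k ^ 2 * (h * j / k : ℕ) := fun j => by
    have : ((h * j % k : ℕ) : ℚ) = h * j - k * (h * j / k : ℕ) := by
      rw [eq_sub_iff_add_eq]
      exact_mod_cast Nat.mod_add_div (h * j) k
    rw [this]
    ring
  rw [Finset.sum_congr rfl fun j _ => hmod j, Finset.sum_sub_distrib, Finset.sum_add_distrib,
    Finset.sum_sub_distrib, ← Finset.mul_sum, ← Finset.mul_sum, ← Finset.mul_sum, ← Finset.mul_sum,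
    sum_range_mul_div hc hk, sum_range_triangle hc hk hh, sum_range_cast_sq_rat] at hsq
  have htri : ∑ m ∈ Finset.range h, (m : ℚ) * (k - 1 - (k * m / h : ℕ)) =
      (k - 1) * (h * (h - 1) / 2) - ∑ m ∈ Finset.range h, (m : ℚ) * (k * m / h : ℕ) := by
    rw [← sum_range_cast_rat, Finset.mul_sum, ← Finset.sum_sub_distrib]
    exact Finset.sum_congr rfl fun m _ => by ring
  rw [htri] at hsq
  set A := ∑ j ∈ Finset.range k, (j : ℚ) * (h * j / k : ℕ)
  set B := ∑ m ∈ Finset.range h, (m : ℚ) * (k * m / h : ℕ)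
  have hAB : h * A + k * B = (((h:ℚ) ^ 2 - 1) * ((k - 1) * (2 * k - 1) / 6)
      + 2 * k * ((k - 1) * (h * (h - 1) / 2)) - k * (((h : ℚ) - 1) * (k - 1) / 2)) / 2 := by
    refine mul_left_cancel₀ hk0 ?_
    linarith
  field_simp
  linear_combination (-288 : ℚ) * hAB
-- Transformation law of the odd theta-function
open Complex in
/-- The transformation law of the odd theta-function under a matrix with lower row `(c, d)`, `c > 0`,
together with the fact that its multiplier is an eighth root of unity. -/
theorem thetaChar_odd_transform (c : ℕ) (hc : 0 < c) (a b d : ℤ) (hdet : a * d - b * c = 1) :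
    (∃ m : ℤ, 12 * (((a : ℚ) + d) / (12 * c) - dedekindSum d c - 1 / 4) = m) ∧
    ∀ z τ : ℂ, 0 < τ.im →
      thetaChar (-1) (-1) (z / (c * τ + d)) ((a * τ + b) / (c * τ + d)) =
        cexp (3 * Real.pi * I *
            ((((a : ℚ) + d) / (12 * c) - dedekindSum d c - 1 / 4 : ℚ) : ℂ)) *
          (c * τ + d) ^ (1 / 2 : ℂ) * cexp (Real.pi * I * c * z ^ 2 / (c * τ + d)) *
          thetaChar (-1) (-1) z τ := by
  induction c using Nat.strong_induction_on generalizing a b d with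
  | _ c ih =>
  have hc0 : (c : ℚ) ≠ 0 := by exact_mod_cast hc.ne'
  rcases Nat.eq_or_lt_of_le (Nat.succ_le_of_lt hc) with h1 | h1
  · obtain rfl : c = 1 := h1.symm
    have hb : b = a * d - 1 := by push_cast at hdet; linarith
    refine ⟨⟨a + d - 3, ?_⟩, fun z τ hτ => ?_⟩
    · rw [dedekindSum_one]; push_cast; ring
    · have him : 0 < (τ + d).im := by simpa using hτ
      have hne : τ + d ≠ 0 := fun h => by rw [h] at him; simp at him
      have e1 : ((a : ℂ) * τ + b) / (((1 : ℕ) : ℂ) * τ + d) = -1 / (τ + d) + a := by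
        rw [hb]; push_cast; field_simp; ring
      rw [e1, thetaChar_odd_add_int, dedekindSum_one]
      simp only [Nat.cast_one, one_mul, mul_one]
      rw [thetaChar_odd_inversion him, thetaChar_odd_add_int]
      have e2 : cexp (3 * Real.pi * I * ((((a : ℚ) + d) / 12 - 0 - 1 / 4 : ℚ) : ℂ)) =
          cexp (Real.pi * I * (a / 4)) * cexp (-(3 * Real.pi * I / 4)) *
            cexp (Real.pi * I * (d / 4)) := by
        rw [← Complex.exp_add, ← Complex.exp_add]
        congr 1
        push_cast
        ring
      rw [e2]
      ring
  · set n : ℤ := d / c with hn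
    set e : ℤ := d % c with he
    have hd : d = e + n * c := by rw [he, hn, mul_comm, Int.emod_add_mul_ediv]
    have hcop : IsCoprime d (c : ℤ) := ⟨a, -b, by linarith⟩
    have hcZ : (0 : ℤ) < c := by exact_mod_cast hc
    have he0 : 0 < e := by
      refine lt_of_le_of_ne (Int.emod_nonneg _ hcZ.ne') fun h => ?_
      rw [← h, zero_add] at hd
      rw [hd] at hdet
      have : (c : ℤ) ∣ 1 := ⟨a * n - b, by linarith⟩
      have := Int.le_of_dvd one_pos this
      omega
    have hec : e < c := Int.emod_lt_of_pos _ hcZ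
    obtain ⟨r, hr⟩ := Int.eq_ofNat_of_zero_le he0.le
    rw [hr] at hd he0 hec
    have hr0 : 0 < r := by exact_mod_cast he0
    have hrQ : (r : ℚ) ≠ 0 := by exact_mod_cast hr0.ne'
    have hrC : (r : ℂ) ≠ 0 := by exact_mod_cast hr0.ne'
    have hrc : r < c := by exact_mod_cast hec
    have hdet' : a * r - (b - n * a) * c = 1 := by rw [hd] at hdet; linarith
    have hcop' : IsCoprime (r : ℤ) (c : ℤ) := ⟨a, -(b - n * a), by linarith⟩
    -- With `S : τ ↦ -1/τ` and `T : τ ↦ τ + 1`, the matrix with rows `(b - na, -a)` and `(r, -c)`,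
    -- times `S T^n`, is minus the given one. The minus sign is why the law is applied at `-(z/σ)`
    -- below.
    obtain ⟨⟨m, hm⟩, hlaw⟩ := ih r hrc hr0 (b - n * a) (-a) (-c) (by linarith)
    have hrec := dedekindSum_reciprocity (Nat.isCoprime_iff_coprime.1 hcop') hc hr0
    have hdetQ : (a : ℚ) * r - (b - n * a) * c = 1 := by exact_mod_cast hdet'
    have hκ : ((a : ℚ) + d) / (12 * c) - dedekindSum d c - 1 / 4 =
        (((b - n * a : ℤ) : ℚ) + ((-c : ℤ) : ℚ)) / (12 * r) - dedekindSum (-c) r - 1 / 4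
          + 1 / 4 + n / 12 := by
      rw [dedekindSum_neg hcop'.symm, hd, dedekindSum_add_mul, eq_sub_iff_add_eq.2 hrec]
      push_cast
      field_simp
      linear_combination 4 * hdetQ
    refine ⟨⟨m + 3 + n, ?_⟩, fun z τ hτ => ?_⟩
    · rw [hκ]; push_cast; push_cast at hm; linarith
    · rw [hκ]
      generalize (((b - n * a : ℤ) : ℚ) + ((-c : ℤ) : ℚ)) / (12 * r) - dedekindSum (-c) r - 1 / 4
        = κ at hlaw ⊢
      set σ : ℂ := τ + n with hσ
      have hσim : 0 < σ.im := by simpa [hσ] using hτ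
      have hσ0 : σ ≠ 0 := fun h => by rw [h] at hσim; simp at hσim
      have hJ : (c : ℂ) * τ + d = c * σ + r := by rw [hd, hσ]; push_cast; ring
      have hJim : 0 < ((c : ℂ) * σ + r).im := by
        simpa using mul_pos (show (0 : ℝ) < c by exact_mod_cast hc) hσim
      have hJ0 : (c : ℂ) * σ + r ≠ 0 := fun h => by rw [h] at hJim; simp at hJim
      have hinv : 0 < (-1 / σ).im := by
        rw [neg_div, one_div, Complex.neg_im, Complex.inv_im, neg_div, neg_neg]
        exact div_pos hσim (Complex.normSq_pos.2 hσ0)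
      have hK : (r : ℂ) * (-1 / σ) + ((-c : ℤ) : ℂ) = -(c * σ + r) / σ := by
        push_cast; field_simp; ring
      have hKim : 0 < ((r : ℂ) * (-1 / σ) + ((-c : ℤ) : ℂ)).im := by
        have : 0 < (r : ℝ) * (-1 / σ).im := mul_pos (by exact_mod_cast hr0) hinv
        simpa using this
      have hsqrt := cpow_half_mul_of_mul_eq_neg hJim hσim hKim (by rw [hK]; field_simp)
      have hlaw' := hlaw (-(z / σ)) (-1 / σ) hinv
      have e1 : -(z / σ) / ((r : ℂ) * (-1 / σ) + ((-c : ℤ) : ℂ)) = z / (c * τ + d) := by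
        rw [hK, hJ]; field_simp
      have e2 : (((b - n * a : ℤ) : ℂ) * (-1 / σ) + ((-a : ℤ) : ℂ)) /
          ((r : ℂ) * (-1 / σ) + ((-c : ℤ) : ℂ)) = (a * τ + b) / (c * τ + d) := by
        have : (a : ℂ) * τ + b = a * σ + (b - n * a) := by rw [hσ]; ring
        rw [hK, hJ, this]; push_cast; field_simp; ring
      rw [e1, e2, thetaChar_odd_neg, thetaChar_odd_inversion hσim, hσ, thetaChar_odd_add_int, ← hσ]
        at hlaw'
      rw [hlaw', hJ]
      -- Here `-I` joins the sign from oddness to the factor `I` from the square roots; the witness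
      -- `1` below is the full turn between `3π/4` and `-3π/4 - π/2`.
      have e3 : cexp (3 * Real.pi * I * ((κ + 1 / 4 + n / 12 : ℚ) : ℂ)) =
          cexp (3 * Real.pi * I * (κ : ℂ)) * cexp (-(3 * Real.pi * I / 4)) *
            cexp (Real.pi * I * (n / 4)) * (-I) := by
        have : -I = cexp (-(Real.pi / 2 * I)) := by
          rw [Complex.exp_neg, Complex.exp_pi_div_two_mul_I, Complex.inv_I]
        rw [this, ← Complex.exp_add, ← Complex.exp_add, ← Complex.exp_add,
          Complex.exp_eq_exp_iff_exists_int]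
        refine ⟨1, ?_⟩
        push_cast
        ring
      have e4 : cexp (Real.pi * I * r * (-(z / σ)) ^ 2 / ((r : ℂ) * (-1 / σ) + ((-c : ℤ) : ℂ))) *
          cexp (Real.pi * I * z ^ 2 / σ) = cexp (Real.pi * I * c * z ^ 2 / (c * σ + r)) := by
        have aux : ∀ J : ℂ, J ≠ 0 → J = c * σ + r → Real.pi * I * r * (-(z / σ)) ^ 2 / (-J / σ) +
            Real.pi * I * z ^ 2 / σ = Real.pi * I * c * z ^ 2 / J := fun J h0 h => by
          field_simp
          rw [h]
          ring
        rw [← Complex.exp_add, hK, aux _ hJ0 rfl]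
      rw [e3, ← e4]
      linear_combination (-cexp (3 * Real.pi * I * (κ : ℂ)) * cexp (-(3 * Real.pi * I / 4)) *
        cexp (Real.pi * I * (n / 4)) * cexp (Real.pi * I * r * (-(z / σ)) ^ 2 /
          ((r : ℂ) * (-1 / σ) + ((-c : ℤ) : ℂ))) * cexp (Real.pi * I * z ^ 2 / σ) *
          thetaChar (-1) (-1) z τ) * hsqrt

/-! ### The exponent of `ℵ` as a Dedekind sum -/

theorem integerPart_natCast_div (m n : ℕ) : integerPart ((m : ℚ) / n) = (m / n : ℕ) := by
  rw [integerPart, if_pos (by positivity), Rat.floor_natCast_div_natCast]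
  norm_cast

theorem integerPart_neg (x : ℚ) : integerPart (-x) = -integerPart x := by
  rcases lt_trichotomy x 0 with h | rfl | h
  · rw [integerPart, integerPart, if_pos (by linarith), if_neg (by linarith), Int.floor_neg]
  · simp [integerPart]
  · rw [integerPart, integerPart, if_neg (by linarith), if_pos h.le, Int.ceil_neg]

/-- Dropping the vanishing terms, for a positive lower right entry. -/
theorem sum_Icc_integerPart {c d : ℕ} (hc : 0 < c) (hd : 0 < d) (hcop : Nat.Coprime d c) :
    ∑ k ∈ Finset.Icc (|integerPart ((c : ℚ) / d)| + 1) ((c : ℤ) - 1),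
        (integerPart ((d : ℚ) / c * k) : ℚ) * (k : ℚ) =
      ∑ j ∈ Finset.range c, (j : ℚ) * (d * j / c : ℕ) := by
  have hI : (Finset.Icc (|integerPart ((c : ℚ) / d)| + 1) ((c : ℤ) - 1)) =
      (Finset.Ico (c / d + 1) c).map Nat.castEmbedding := by
    rw [integerPart_natCast_div, abs_of_nonneg (Int.natCast_nonneg _)]
    generalize c / d = q
    ext x
    simp only [Finset.mem_Icc, Finset.mem_map, Finset.mem_Ico, Nat.castEmbedding_apply]
    refine ⟨fun h => ⟨x.toNat, ?_, ?_⟩, ?_⟩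
    · omega
    · omega
    · rintro ⟨y, hy, rfl⟩
      omega
  rw [hI, Finset.sum_map]
  have hterm : ∀ j : ℕ, (integerPart ((d : ℚ) / c * ((Nat.castEmbedding j : ℤ) : ℚ)) : ℚ) *
      ((Nat.castEmbedding j : ℤ) : ℚ) = (j : ℚ) * (d * j / c : ℕ) := fun j => by
    have : (d : ℚ) / c * ((Nat.castEmbedding j : ℤ) : ℚ) = ((d * j : ℕ) : ℚ) / c := by
      simp; ring
    rw [this, integerPart_natCast_div, Int.cast_natCast, Nat.castEmbedding_apply,
      Int.cast_natCast, mul_comm]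
  rw [Finset.sum_congr rfl fun j _ => hterm j]
  refine Finset.sum_subset (fun j hj => ?_) fun j hj hj' => ?_
  · exact Finset.mem_range.2 (Finset.mem_Ico.1 hj).2
  · have hjc := Finset.mem_range.1 hj
    have hle : j ≤ c / d := by
      by_contra h
      exact hj' (Finset.mem_Ico.2 ⟨by omega, hjc⟩)
    rw [Nat.le_div_iff_mul_le hd] at hle
    -- Equality `d j = c` would force `d = 1` by coprimality, hence `j = c`, outside the range.
    have hlt : d * j < c := by
      refine lt_of_le_of_ne (by linarith) fun h => ?_
      have h1 : d = 1 := Nat.dvd_one.1 (hcop ▸ Nat.dvd_gcd dvd_rfl ⟨j, h.symm⟩)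
      rw [h1, one_mul] at h
      omega
    rw [Nat.div_eq_of_lt hlt]
    simp

/-- The exponent of `ℵ` in terms of a Dedekind sum. -/
theorem alephExponent_eq (a d : ℤ) {c : ℕ} (hc : 0 < c) (hcop : IsCoprime d (c : ℤ)) :
    alephExponent a c d = ((a : ℚ) + d) / (12 * c) - dedekindSum d c - 1 / 4 := by
  have hc0 : (c : ℚ) ≠ 0 := by exact_mod_cast hc.ne'
  rw [alephExponent]
  push_cast
  rcases lt_trichotomy d 0 with h | rfl | h
  -- Truncation is odd, like the sign and the Dedekind sum, so negative `d` reduces to positive.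
  · obtain ⟨n, hn⟩ := Int.eq_ofNat_of_zero_le (neg_nonneg.2 h.le)
    obtain rfl : d = -(n : ℤ) := by rw [← hn, neg_neg]
    have hn0 : 0 < n := by omega
    have hcop' : IsCoprime (n : ℤ) (c : ℤ) := (IsCoprime.neg_left_iff _ _).1 hcop
    have hs : ∑ k ∈ Finset.Icc (|integerPart ((c : ℚ) / ((-(n : ℤ) : ℤ) : ℚ))| + 1) ((c : ℤ) - 1),
        (integerPart (((-(n : ℤ) : ℤ) : ℚ) / c * k) : ℚ) * (k : ℚ) =
        -∑ j ∈ Finset.range c, (j : ℚ) * (n * j / c : ℕ) := by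
      rw [← sum_Icc_integerPart hc hn0 (Nat.isCoprime_iff_coprime.1 hcop'),
        ← Finset.sum_neg_distrib]
      push_cast
      rw [div_neg, integerPart_neg, abs_neg]
      refine Finset.sum_congr rfl fun k _ => ?_
      rw [neg_div, neg_mul, integerPart_neg]
      push_cast
      ring
    push_cast at hs
    have hsign : (-(n : ℤ)).sign = -1 := Int.sign_eq_neg_one_of_neg h
    rw [dedekindSum_neg hcop', dedekindSum_eq_sum_div n c hc, hsign]
    push_cast
    rw [hs]
    field_simp
    ring
  -- Here `c / 0 = 0` in `ℚ`, so the summation range is `Icc 1 0`, which is empty.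
  · obtain rfl : c = 1 := by
      have := Int.isUnit_iff.1 (isCoprime_zero_left.1 hcop)
      omega
    rw [dedekindSum_one]
    simp [integerPart]
  · obtain ⟨n, rfl⟩ := Int.eq_ofNat_of_zero_le h.le
    have hn0 : 0 < n := by omega
    have hs := sum_Icc_integerPart hc hn0 (Nat.isCoprime_iff_coprime.1 hcop)
    have hsign : (n : ℤ).sign = 1 := Int.sign_eq_one_of_pos h
    rw [dedekindSum_eq_sum_div n c hc, hsign]
    push_cast
    rw [hs]
    field_simp
    ring
-- General characteristics
open Complex in
theorem exp_two_pi_mul_int (x : ℂ) (m : ℤ) (h : x = 2 * Real.pi * I * m) : cexp x = 1 :=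
  Complex.exp_eq_one_iff.2 ⟨m, by rw [h]; ring⟩

open Complex in
theorem multE_pow_eight (α β a b c d : ℤ) : multE α β a b c d ^ 8 = 1 := by
  rw [multE, ← Complex.exp_nat_mul]
  refine exp_two_pi_mul_int _
    (2 * α * (β * b * c - d + 1) - β * c * (β * a - 2) - α ^ 2 * d * b) ?_
  push_cast
  ring

open Complex in
-- Division by `cτ + d` carries the half-period `(ατ + β)/2` to the one with characteristics `α',
-- β'` at the transformed point (`hz`). Comparing the Gaussian factors (`hexp`) leaves a constant
-- independent of `z` and `τ`.
theorem thetaChar_transform_of_odd {a b c d : ℂ} {α β α' β' : ℤ} {A : ℂ} (hdet : a * d - b * c = 1)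
    (hα : (α' : ℂ) = d * α - c * β) (hβ : (β' : ℂ) = -b * α + a * β) {τ : ℂ}
    (hJ : c * τ + d ≠ 0)
    (h : ∀ z : ℂ, thetaChar (-1) (-1) (z / (c * τ + d)) ((a * τ + b) / (c * τ + d)) =
      A * cexp (Real.pi * I * c * z ^ 2 / (c * τ + d)) * thetaChar (-1) (-1) z τ) (z : ℂ) :
    thetaChar (α' - 1) (β' - 1) (z / (c * τ + d)) ((a * τ + b) / (c * τ + d)) =
      cexp (Real.pi / 4 * I * (2 * α * (β * b * c - d + 1) - β * c * (β * a - 2) - α ^ 2 * d * b)) *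
        A * cexp (Real.pi * I * c * z ^ 2 / (c * τ + d)) * thetaChar (α - 1) (β - 1) z τ := by
  have hz : z / (c * τ + d) + (α' * ((a * τ + b) / (c * τ + d)) + β') / 2 =
      (z + (α * τ + β) / 2) / (c * τ + d) := by
    rw [hα, hβ]
    field_simp
    linear_combination (α * τ + β) * hdet
  have hexp : Real.pi * I * ((α' : ℂ) ^ 2 * ((a * τ + b) / (c * τ + d)) / 4 +
        α' * (z / (c * τ + d) + (β' + ((-1 : ℤ) : ℂ)) / 2)) +
        Real.pi * I * c * (z + (α * τ + β) / 2) ^ 2 / (c * τ + d) =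
      Real.pi / 4 * I * (2 * α * (β * b * c - d + 1) - β * c * (β * a - 2) - α ^ 2 * d * b) +
        Real.pi * I * c * z ^ 2 / (c * τ + d) +
        Real.pi * I * ((α : ℂ) ^ 2 * τ / 4 + α * (z + (β + ((-1 : ℤ) : ℂ)) / 2)) := by
    rw [hα, hβ]
    push_cast
    field_simp
    linear_combination (8 * d * α * β + 4 * d * α ^ 2 * τ - 4 * c * β ^ 2) * hdet
  rw [sub_eq_add_neg, sub_eq_add_neg, sub_eq_add_neg α, sub_eq_add_neg β, thetaChar_add,
    thetaChar_add α β, hz, h]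
  linear_combination A * thetaChar (-1) (-1) (z + (α * τ + β) / 2) τ *
    (by simpa only [Complex.exp_add] using congrArg cexp hexp :
      cexp _ * cexp _ = cexp _ * cexp _ * cexp _)

theorem theorem6 :
    (∀ (n α β : ℤ) (z τ : ℂ), 0 < τ.im →
      thetaChar (α - 1) β z (τ + n) =
        Complex.I ^ ((n : ℂ) / 2 * (1 - (α : ℂ) ^ 2)) * thetaChar (α - 1) (β + n * α) z τ) ∧
    (∀ a b c d : ℤ, a * d - b * c = 1 → 0 < c →
      multAleph a c d ^ 8 = 1 ∧
      ∀ α β α' β' : ℤ,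
        ((α' = d * α - c * β ∧ β' = -b * α + a * β) ↔
          (α = a * α' + c * β' ∧ β = b * α' + d * β')) ∧
        (α' = d * α - c * β → β' = -b * α + a * β →
          multE α β a b c d ^ 8 = 1 ∧
          ∀ z τ : ℂ, 0 < τ.im →
            thetaChar (α' - 1) (β' - 1) (z / (c * τ + d)) ((a * τ + b) / (c * τ + d)) =
              multE α β a b c d * multAleph a c d * ((c : ℂ) * τ + d) ^ (1 / 2 : ℂ) *
                Complex.exp (Real.pi * Complex.I * c * z ^ 2 / (c * τ + d)) *
                thetaChar (α - 1) (β - 1) z τ)) := by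
  refine ⟨fun n α β z τ _ => ?_, fun a b c d hdet hc => ?_⟩
  · rw [thetaChar_add_int, show (n : ℂ) / 2 * (1 - (α : ℂ) ^ 2) = n * (1 - (α : ℂ) ^ 2) / 2 by ring,
      I_cpow_half_mul]
  obtain ⟨c, rfl⟩ := Int.eq_ofNat_of_zero_le hc.le
  have hc' : 0 < c := by exact_mod_cast hc
  have hcop : IsCoprime d (c : ℤ) := ⟨a, -b, by linarith⟩
  obtain ⟨⟨m, hm⟩, hlaw⟩ := thetaChar_odd_transform c hc' a b d hdet
  rw [← alephExponent_eq a d hc' hcop] at hm hlaw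
  refine ⟨?_, fun α β α' β' => ⟨⟨?_, ?_⟩, fun hα hβ => ⟨multE_pow_eight α β a b c d, ?_⟩⟩⟩
  -- Since `8 · 3πi x = 2πi · 12x`, integrality of twelve times the exponent suffices.
  · rw [multAleph, ← Complex.exp_nat_mul]
    have hm' : (12 : ℂ) * (alephExponent a c d : ℂ) = m := by exact_mod_cast hm
    refine exp_two_pi_mul_int _ m ?_
    push_cast
    linear_combination 2 * Real.pi * Complex.I * hm'
  · rintro ⟨rfl, rfl⟩
    exact ⟨by linear_combination (-α) * hdet, by linear_combination (-β) * hdet⟩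
  · rintro ⟨rfl, rfl⟩
    exact ⟨by linear_combination (-α') * hdet, by linear_combination (-β') * hdet⟩
  · intro z τ hτ
    have him : 0 < ((c : ℂ) * τ + d).im := by
      simpa using mul_pos (show (0 : ℝ) < c by exact_mod_cast hc') hτ
    have hJ : (c : ℂ) * τ + d ≠ 0 := fun h => by rw [h] at him; simp at him
    have key := thetaChar_transform_of_odd (a := a) (b := b) (c := c) (d := d) (α := α) (β := β)
      (by exact_mod_cast hdet) (by exact_mod_cast hα) (by exact_mod_cast hβ) hJ
      (fun w => hlaw w τ hτ) z
    rw [multE, multAleph]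
    push_cast
    rw [key]
    ring
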